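/- Let $L$ be a relational language (with arbitrarily many relation symbols) containing a binary relation symbol $<$, and let $U\subseteq L\setminus\{<\}$ be a set of relation symbols, each of arity at least $2$. An $L$-structure $\mathbf A$ with vertex set $A$ is called ordered if $<_{\mathbf A}$ is a (strict) linear order of $A$. An embedding $\mathbf A\to\mathbf B$ is an injective map $A\to B$ that preserves and reflects every relation in $L$. An embedding $f\colon\mathbf A\to\mathbf B$ is called $U$-closed if for every $R\in U$, of arity $n+1$ say, and every tuple $(x_0,\dots,x_{n-1},x_n)\in R_{\mathbf B}$ with $x_0,\dots,x_{n-1}\in f[A]$, also $x_n\in f[A]$. Write $\mathrm{Emb}(\mathbf A,\mathbf B)_U$ for the set of all $U$-closed embeddings $\mathbf A\to\mathbf B$, and write $\mathbf C\longrightarrow_U(\mathbf B)^{\mathbf A}_2$ if for every colouring $\chi\colon\mathrm{Emb}(\mathbf A,\mathbf C)_U\to\{0,1\}$ there is $f\in\mathrm{Emb}(\mathbf B,\mathbf C)_U$ such that $\chi$ is constant on $\{f\circ e : e\in\mathrm{Emb}(\mathbf A,\mathbf B)_U\}$. Theorem. For all finite ordered $L$-structures $\mathbf A$ and $\mathbf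 B$ there is a finite ordered $L$-structure $\mathbf C$ such that $\mathbf C\longrightarrow_U(\mathbf B)^{\mathbf A}_2$. -/

import Mathlib

universe u v w

namespace UClosedRamsey

open FirstOrder FirstOrder.Language

/-- A structure `M` is ordered (with respect to the binary relation symbol `lt`) if the
interpretation of `lt` is a strict linear order of its vertex set. -/
def IsOrdered {L : FirstOrder.Language.{u, v}} (lt : L.Relations 2) (M : Type w) [L.Structure M] : Prop :=
  IsStrictTotalOrder M (fun x y : M => Structure.RelMap lt ![x, y])

/-- A substructure `S` of `M` is `U`-closed if for every symbol `R` in `U` of arity `n + 1` and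
every tuple `(x 0, …, x n)` in the relation `R` of `M` whose first `n` entries lie in `S`, the last
entry lies in `S` as well. -/
def IsUClosed {L : FirstOrder.Language.{u, v}} (U : Set (Σ n, L.Relations n)) {M : Type w} [L.Structure M]
    (S : L.Substructure M) : Prop :=
  ∀ (n : ℕ) (R : L.Relations (n + 1)), (⟨n + 1, R⟩ : Σ n, L.Relations n) ∈ U →
    ∀ x : Fin (n + 1) → M, Structure.RelMap R x →
      (∀ i : Fin n, x i.castSucc ∈ S) → x (Fin.last n) ∈ S

/-- The set of `U`-closed embeddings: those whose image is a `U`-closed substructure. -/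
def UEmb {L : FirstOrder.Language.{u, v}} (U : Set (Σ n, L.Relations n)) (M N : Type w)
    [L.Structure M] [L.Structure N] : Type w :=
  {f : M ↪[L] N // IsUClosed U f.toHom.range}

/-- Composites of `U`-closed embeddings are `U`-closed. -/
theorem isUClosed_comp {L : FirstOrder.Language.{u, v}} (U : Set (Σ n, L.Relations n)) {M N P : Type w}
    [L.Structure M] [L.Structure N] [L.Structure P] (f : N ↪[L] P) (e : M ↪[L] N)
    (hf : IsUClosed U f.toHom.range) (he : IsUClosed U e.toHom.range) :
    IsUClosed U (f.comp e).toHom.range := by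
  intro n R hR x hx hS
  simp only [Hom.mem_range] at hS
  choose y hy using hS
  have hlast : x (Fin.last n) ∈ f.toHom.range :=
    hf n R hR x hx fun i => Hom.mem_range.2 ⟨e (y i), hy i⟩
  obtain ⟨z, hz⟩ := Hom.mem_range.1 hlast
  have hxe : x = f ∘ (Fin.snoc (fun i => e (y i)) z : Fin (n + 1) → N) := by
    funext i
    refine Fin.lastCases ?_ (fun i => ?_) i
    · simpa using hz.symm
    · simpa using (hy i).symm
  rw [hxe, f.map_rel] at hx
  have h := he n R hR _ hx fun i => Hom.mem_range.2 ⟨y i, by simp⟩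
  obtain ⟨t, ht⟩ := Hom.mem_range.1 h
  refine Hom.mem_range.2 ⟨t, ?_⟩
  have ht' : e t = z := by simpa using ht
  rw [← hz, ← ht']
  rfl

/-- Composition of `U`-closed embeddings. -/
def UEmb.comp {L : FirstOrder.Language.{u, v}} {U : Set (Σ n, L.Relations n)} {M N P : Type w}
    [L.Structure M] [L.Structure N] [L.Structure P] (f : UEmb U N P) (e : UEmb U M N) :
    UEmb U M P :=
  ⟨f.1.comp e.1, isUClosed_comp U f.1 e.1 f.2 e.2⟩

/-- The partition arrow `C ⟶_U (B)^A_r`: for every colouring of the `U`-closed embeddings of `A`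
in `C` with `r` colours there is a `U`-closed embedding `f` of `B` in `C` such that the colouring
is constant on all `f ∘ e`, where `e` is a `U`-closed embedding of `A` in `B`. -/
def Arrow {L : FirstOrder.Language.{u, v}} (U : Set (Σ n, L.Relations n)) (C B A : Type w)
    [L.Structure C] [L.Structure B] [L.Structure A] (r : ℕ) : Prop :=
  ∀ χ : UEmb U A C → Fin r, ∃ f : UEmb U B C, ∀ e e' : UEmb U A B, χ (f.comp e) = χ (f.comp e')

end UClosedRamsey

/-! This is a partite construction with a second one nested inside each step. Start from disjoint
copies of `B`, one for each increasing map `B → Fin N`, with vertices labelled by the values of that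
map. For each injective labelling `a` of `A`, a partite step makes the colour constant on the closed
copies of `A` labelled `a` inside some copy of the previous structure. Every related tuple stays in
a closed, label-preserving copy of that structure (`Covered`). In the end the colour depends only on
the labelling, and `exists_ramsey_strictMono` selects a copy of `B`.

A basic step glues copies of `V` along Hales–Jewett lines whose letters are the closed copies of `A`
labelled `a`. The glued copies are shown closed when `a` is good (`IsGood`). For arbitrary `a`,
`exists_monoOver_singleton` keeps the copies disjoint and labels their vertices by positions in the
glued object. Words of copies are then good labellings. After a basic step for each word the colour
depends only on the word, and Hales–Jewett gives a line.

Until the end `<` is an ordinary relation. It is then extended to a linear order by comparing labels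
first; since `<` is not in `U`, closedness survives. -/

namespace UClosedRamsey

open FirstOrder FirstOrder.Language Function

/-! ### Closed embeddings, covering and good labellings. -/

section Closed

variable {L : FirstOrder.Language.{u, v}} (U : Set (Σ n, L.Relations n))

/-- A map of structures which is an embedding for all relations and has a `U`-closed image. -/
structure IsClosedEmb {V W : Type*} [L.Structure V] [L.Structure W] (f : V → W) : Prop where
  inj : Injective f
  rel : ∀ {n : ℕ} (R : L.Relations n) (x : Fin n → V),
    Structure.RelMap R (f ∘ x) ↔ Structure.RelMap R x
  closed : ∀ {n : ℕ} (R : L.Relations (n + 1)), (⟨n + 1, R⟩ : Σ n, L.Relations n) ∈ U →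
    ∀ x : Fin (n + 1) → W, Structure.RelMap R x →
      (∀ i : Fin n, ∃ v, f v = x i.castSucc) → ∃ v, f v = x (Fin.last n)

variable {U}

theorem IsClosedEmb.comp {V W Z : Type*} [L.Structure V] [L.Structure W] [L.Structure Z]
    {f : W → Z} {e : V → W} (hf : IsClosedEmb U f) (he : IsClosedEmb U e) :
    IsClosedEmb U (f ∘ e) where
  inj := hf.inj.comp he.inj
  rel R x := by rw [Function.comp_assoc, hf.rel, he.rel]
  closed {n} R hR x hx h := by
    choose y hy using h
    obtain ⟨z, hz⟩ := hf.closed R hR x hx fun i => ⟨e (y i), hy i⟩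
    have hxe : x = f ∘ (Fin.snoc (fun i => e (y i)) z : Fin (n + 1) → W) := by
      funext i
      refine Fin.lastCases ?_ (fun i => ?_) i
      · simpa using hz.symm
      · simpa using (hy i).symm
    rw [hxe, hf.rel] at hx
    obtain ⟨t, ht⟩ := he.closed R hR _ hx fun i => ⟨y i, by simp⟩
    refine ⟨t, ?_⟩
    have ht' : e t = z := by simpa using ht
    rw [Function.comp_apply, ht', hz]

/-- The structure whose relations are the images of those of `V` under a family of maps. -/
@[reducible] def imageStructure [L.IsRelational] {V W I : Type*} [L.Structure V] (e : I → V → W) :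
    L.Structure W where
  funMap f := isEmptyElim f
  RelMap R x := ∃ (i : I) (y : _ → V), Structure.RelMap R y ∧ x = e i ∘ y

/-- `(W, q)` is covered by copies of `(V, p)` when each tuple in a relation of `W` comes from
a closed, label preserving copy of `V`. -/
def Covered (U : Set (Σ n, L.Relations n)) {V W X : Type*} [L.Structure V] [L.Structure W]
    (p : V → X) (q : W → X) : Prop :=
  ∀ (n : ℕ) (R : L.Relations n) (x : Fin n → W), Structure.RelMap R x →
    ∃ e : V → W, IsClosedEmb U e ∧ q ∘ e = p ∧ ∃ y, Structure.RelMap R y ∧ x = e ∘ y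

theorem Covered.trans {V W Z X : Type*} [L.Structure V] [L.Structure W] [L.Structure Z]
    {p : V → X} {q : W → X} {r : Z → X} (h : Covered U p q) (h' : Covered U q r) :
    Covered U p r := by
  intro n R x hx
  obtain ⟨e, he, hre, y, hy, rfl⟩ := h' n R x hx
  obtain ⟨f, hf, hqf, z, hz, rfl⟩ := h n R y hy
  exact ⟨e ∘ f, he.comp hf, by rw [← Function.comp_assoc, hre, hqf], z, hz, rfl⟩

/-- Every colouring of copies of `A` admits a copy of `(V, p)` in `(W, q)` on which the
colour of a closed copy of `A` with labels `a` does not depend on the copy. -/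
def MonoOver (U : Set (Σ n, L.Relations n)) {A V W X : Type*} [L.Structure A] [L.Structure V]
    [L.Structure W] (p : V → X) (q : W → X) (S : Set (A → X)) : Prop :=
  ∀ χ : (A → W) → Fin 2, ∃ e : V → W, IsClosedEmb U e ∧ q ∘ e = p ∧
    ∀ a ∈ S, ∀ g g' : A → V, IsClosedEmb U g → IsClosedEmb U g' → p ∘ g = a → p ∘ g' = a →
      χ (e ∘ g) = χ (e ∘ g')

/-- The part of `V` with labels in the range of `a` is closed, and the relations in `U` reflect
to `A` there. -/
def IsGood (U : Set (Σ n, L.Relations n)) {A V X : Type*} [L.Structure A] [L.Structure V]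
    (p : V → X) (a : A → X) : Prop :=
  ∀ (n : ℕ) (R : L.Relations (n + 1)), (⟨n + 1, R⟩ : Σ n, L.Relations n) ∈ U →
    ∀ (z : Fin (n + 1) → V) (t : Fin n → A), Structure.RelMap R z →
      (∀ k, p (z k.castSucc) = a (t k)) →
      ∃ s, p (z (Fin.last n)) = a s ∧ Structure.RelMap R (Fin.snoc t s : Fin (n + 1) → A)

/-- Goodness concerns one related tuple at a time, and each comes from a copy of `V` with the same
labels. Hence good steps can be iterated. -/
theorem IsGood.of_covered {A V W X : Type*} [L.Structure A] [L.Structure V] [L.Structure W]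
    {p : V → X} {q : W → X} {a : A → X} (h : IsGood U p a) (hc : Covered U p q) :
    IsGood U q a := by
  intro n R hR z t hz hk
  obtain ⟨e, -, rfl, y, hy, rfl⟩ := hc _ R z hz
  exact h n R hR y t hy hk

/-- In a family of maps, each map is a closed embedding into the image structure as soon as
coincidences between the maps are compatible with the relations. -/
theorem isClosedEmb_imageStructure [L.IsRelational] {V W I : Type*} [L.Structure V] (e : I → V → W)
    (i : I) (hinj : Injective (e i))
    (hrel : ∀ {n : ℕ} (R : L.Relations n) (j : I) (y z : Fin n → V), Structure.RelMap R z →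
      e i ∘ y = e j ∘ z → Structure.RelMap R y)
    (hcl : ∀ {n : ℕ} (R : L.Relations (n + 1)), (⟨n + 1, R⟩ : Σ n, L.Relations n) ∈ U →
      ∀ (j : I) (y : Fin n → V) (z : Fin (n + 1) → V), Structure.RelMap R z →
        (∀ k, e i (y k) = e j (z k.castSucc)) → ∃ s, e i s = e j (z (Fin.last n))) :
    letI := imageStructure (L := L) e
    IsClosedEmb U (e i) := by
  let _ := imageStructure (L := L) e
  refine ⟨hinj, fun R x => ⟨?_, fun h => ⟨i, x, h, rfl⟩⟩, ?_⟩
  · rintro ⟨j, z, hz, h⟩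
    exact hrel R j x z hz h
  · rintro n R hR _ ⟨j, z, hz, rfl⟩ h
    choose y hy using h
    exact hcl R hR j y z hz hy

/-- The summands of a disjoint union are closed. -/
theorem isClosedEmb_prodMk [L.IsRelational] (hU : ∀ R ∈ U, 2 ≤ R.1) {V I : Type*} [L.Structure V]
    (i : I) :
    letI := imageStructure (L := L) (fun (i : I) (v : V) => (i, v))
    IsClosedEmb U (fun v : V => (i, v)) := by
  refine isClosedEmb_imageStructure (fun (i : I) (v : V) => (i, v)) i
    (Prod.mk_right_injective i) ?_ ?_
  · intro n R j y z hz h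
    have : y = z := funext fun k => congrArg Prod.snd (congrFun h k)
    rwa [this]
  · intro n R hR j y z hz h
    -- Arity at least 2 makes the initial segment nonempty, so its first entry identifies the
    -- summand.
    have hn : 2 ≤ n + 1 := hU _ hR
    have : i = j := congrArg Prod.fst (h ⟨0, by omega⟩)
    exact ⟨_, by rw [this]⟩

/-! ### Copies of `V` glued along Hales–Jewett lines. -/

section Letters

variable {A V X : Type*} [L.Structure A] [L.Structure V]

/-- Closed copies of `A` with labels `a`. -/
abbrev Copy (U : Set (Σ n, L.Relations n)) (p : V → X) (a : A → X) : Type _ :=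
  {g : A → V // IsClosedEmb U g ∧ p ∘ g = a}

variable {p : V → X} {a : A → X}

theorem Copy.label (g : Copy U p a) (s : A) : p (g.1 s) = a s := congrFun g.2.2 s

/-- The last entry of a tuple starting in a copy of `A` is determined by its label. -/
theorem Copy.last_eq (ha : Injective a) (g : Copy U p a) {n : ℕ} {R : L.Relations (n + 1)}
    (hR : (⟨n + 1, R⟩ : Σ n, L.Relations n) ∈ U) {z : Fin (n + 1) → V} (hz : Structure.RelMap R z)
    {t : Fin n → A} {s : A} (ht : ∀ k, z k.castSucc = g.1 (t k)) (hs : p (z (Fin.last n)) = a s) :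
    z (Fin.last n) = g.1 s := by
  obtain ⟨s', hs'⟩ := g.2.1.closed R hR z hz fun k => ⟨t k, (ht k).symm⟩
  rw [← hs', g.label] at hs
  rw [← hs', ha hs]

/-- The `g`-image of the tuple starts in the closed copy `g'`, so it also ends there, at the vertex
fixed by its label. -/
theorem Copy.agree (ha : Injective a) (g g' : Copy U p a) {n : ℕ} {R : L.Relations (n + 1)}
    (hR : (⟨n + 1, R⟩ : Σ n, L.Relations n) ∈ U) {t : Fin n → A} {s : A}
    (h : Structure.RelMap R (Fin.snoc t s : Fin (n + 1) → A)) (ht : ∀ k, g.1 (t k) = g'.1 (t k)) :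
    g.1 s = g'.1 s := by
  have := g'.last_eq ha hR ((g.2.1.rel R _).2 h) (t := t) (s := s) (by simpa using ht)
    (by simpa using g.label s)
  simpa using this

variable {ι : Type*}

/-- The coordinate `i` of the image of the vertex `v` with label `a s` on the line `l`. -/
def coord (l : Combinatorics.Line (Copy U p a) ι) (v : V) (s : A) (i : ι) : V :=
  (l.idxFun i).elim v fun g => g.1 s

theorem coord_copy (l : Combinatorics.Line (Copy U p a) ι) (g : Copy U p a) (s : A) :
    coord l (g.1 s) s = fun i => (l g i).1 s := by
  funext i
  simp only [coord, Combinatorics.Line.coe_apply]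
  cases l.idxFun i <;> rfl

theorem coord_none {l : Combinatorics.Line (Copy U p a) ι} {i : ι} (h : l.idxFun i = none)
    (v : V) (s : A) : coord l v s i = v := by simp [coord, h]

theorem coord_some {l : Combinatorics.Line (Copy U p a) ι} {i : ι} {g : Copy U p a}
    (h : l.idxFun i = some g) (v : V) (s : A) : coord l v s i = g.1 s := by simp [coord, h]

open Classical in
/-- The copy of `V` along the line `l`: vertices labelled in the range of `a` become words. -/
noncomputable def lineMap (l : Combinatorics.Line (Copy U p a) ι) (v : V) :
    (A × (ι → V)) ⊕ (Combinatorics.Line (Copy U p a) ι × V) :=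
  if h : ∃ s, p v = a s then .inl (h.choose, coord l v h.choose) else .inr (l, v)

theorem lineMap_inside (ha : Injective a) (l : Combinatorics.Line (Copy U p a) ι) {v : V} {s : A}
    (h : p v = a s) : lineMap l v = .inl (s, coord l v s) := by
  have hex : ∃ s, p v = a s := ⟨s, h⟩
  have : hex.choose = s := ha (hex.choose_spec.symm.trans h)
  rw [lineMap, dif_pos hex, this]

theorem lineMap_outside (l : Combinatorics.Line (Copy U p a) ι) {v : V}
    (h : ¬ ∃ s, p v = a s) : lineMap l v = .inr (l, v) := by
  rw [lineMap, dif_neg h]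

/-- Outside vertices remember their line, so copies along distinct lines meet only over labels in
the range of `a`. -/
theorem lineMap_eq_outside (ha : Injective a) {l m : Combinatorics.Line (Copy U p a) ι} {v w : V}
    (hv : ¬ ∃ s, p v = a s) (h : lineMap l v = lineMap m w) : l = m ∧ v = w := by
  rw [lineMap_outside l hv] at h
  by_cases hw : ∃ s, p w = a s
  · obtain ⟨s, hs⟩ := hw
    rw [lineMap_inside ha m hs] at h
    cases h
  · rw [lineMap_outside m hw] at h
    simpa using h

theorem lineMap_eq_inside (ha : Injective a) {l m : Combinatorics.Line (Copy U p a) ι} {v w : V}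
    {s : A} (hv : p v = a s) (h : lineMap l v = lineMap m w) :
    p w = a s ∧ ∀ i, coord l v s i = coord m w s i := by
  rw [lineMap_inside ha l hv] at h
  by_cases hw : ∃ s, p w = a s
  · obtain ⟨s', hs'⟩ := hw
    rw [lineMap_inside ha m hs'] at h
    simp only [Sum.inl.injEq, Prod.mk.injEq] at h
    obtain ⟨rfl, h⟩ := h
    exact ⟨hs', congrFun h⟩
  · rw [lineMap_outside m hw] at h
    cases h

theorem lineMap_injective (ha : Injective a) (l : Combinatorics.Line (Copy U p a) ι) :
    Injective (lineMap l) := by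
  intro v w h
  by_cases hv : ∃ s, p v = a s
  · obtain ⟨s, hs⟩ := hv
    obtain ⟨i, hi⟩ := l.proper
    simpa [coord_none hi] using (lineMap_eq_inside ha hs h).2 i
  · exact (lineMap_eq_outside ha hv h).2

/-- A tuple shared by distinct lines lies over `a`. An active coordinate of either line reads off
that line's vertices, either as the other line's vertices or as a letter's image of one tuple of
`A`; this transfers relations. For closedness, goodness supplies the last label and a relation in
`A`, which forces the last coordinates to agree. -/
theorem isClosedEmb_lineMap [L.IsRelational] (ha : Injective a) (hg : IsGood U p a)
    (l : Combinatorics.Line (Copy U p a) ι) :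
    letI := imageStructure (L := L)
      (lineMap : Combinatorics.Line (Copy U p a) ι → V → _)
    IsClosedEmb U (lineMap l) := by
  refine isClosedEmb_imageStructure lineMap l (lineMap_injective ha l) ?_ ?_
  · intro n R m y z hz h
    by_cases hlm : l = m
    · subst hlm
      rwa [(lineMap_injective ha l).comp_left h]
    have hin : ∀ k, ∃ s, p (y k) = a s := fun k => by
      by_contra hk
      exact hlm (lineMap_eq_outside ha hk (congrFun h k)).1
    choose t ht using hin
    have hc := fun k => (lineMap_eq_inside ha (ht k) (congrFun h k)).2
    obtain ⟨i, hi⟩ := l.proper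
    obtain ⟨j, hj⟩ := m.proper
    cases hmi : m.idxFun i with
    | none =>
      have : y = z := funext fun k => by simpa [coord_none hi, coord_none hmi] using hc k i
      rwa [this]
    | some g =>
      have hy : y = g.1 ∘ t := funext fun k => by
        simpa [coord_none hi, coord_some hmi] using hc k i
      cases hlj : l.idxFun j with
      | none =>
        have : y = z := funext fun k => by simpa [coord_none hj, coord_none hlj] using hc k j
        rwa [this]
      | some g' =>
        have hz' : z = g'.1 ∘ t := funext fun k => by
          simpa [coord_none hj, coord_some hlj] using (hc k j).symm
        rw [hz', g'.2.1.rel] at hz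
        rwa [hy, g.2.1.rel]
  · intro n R hR m y z hz h
    by_cases hlm : l = m
    · exact ⟨_, by rw [hlm]⟩
    have hin : ∀ k, ∃ s, p (y k) = a s := fun k => by
      by_contra hk
      exact hlm (lineMap_eq_outside ha hk (h k)).1
    choose t ht using hin
    have hc := fun k => (lineMap_eq_inside ha (ht k) (h k)).2
    obtain ⟨s, hs, hA⟩ := hg n R hR z t hz fun k => (lineMap_eq_inside ha (ht k) (h k)).1
    rw [lineMap_inside ha m hs]
    suffices H : ∃ w, p w = a s ∧ ∀ i, coord l w s i = coord m (z (Fin.last n)) s i by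
      obtain ⟨w, hw, hwc⟩ := H
      exact ⟨w, by rw [lineMap_inside ha l hw, funext hwc]⟩
    have both : ∀ i g g', l.idxFun i = some g → m.idxFun i = some g' → g.1 s = g'.1 s := by
      intro i g g' hi hi'
      exact g.agree ha g' hR hA fun k => by simpa [coord_some hi, coord_some hi'] using hc k i
    have right : ∀ i g, l.idxFun i = some g → m.idxFun i = none → z (Fin.last n) = g.1 s := by
      intro i g hi hi'
      exact g.last_eq ha hR hz
        (fun k => by simpa [coord_some hi, coord_none hi'] using (hc k i).symm) hs
    by_cases hcommon : ∃ i, l.idxFun i = none ∧ m.idxFun i = none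
    · obtain ⟨i, hi, hi'⟩ := hcommon
      have hyz : ∀ k, y k = z k.castSucc := fun k => by
        simpa [coord_none hi, coord_none hi'] using hc k i
      -- At a common active coordinate both tuples start identically, so the last entry of `z`
      -- itself is the witness.
      refine ⟨_, hs, fun j => ?_⟩
      cases hlj : l.idxFun j with
      | none =>
        cases hmj : m.idxFun j with
        | none => rw [coord_none hlj, coord_none hmj]
        | some g =>
          rw [coord_none hlj, coord_some hmj]
          exact g.last_eq ha hR hz
            (fun k => by simpa [coord_none hlj, coord_some hmj, hyz] using hc k j) hs
      | some g =>
        cases hmj : m.idxFun j with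
        | none => rw [coord_some hlj, coord_none hmj, right j g hlj hmj]
        | some g' => rw [coord_some hlj, coord_some hmj, both j g g' hlj hmj]
    · obtain ⟨i, hi⟩ := l.proper
      obtain ⟨g₀, hg₀⟩ : ∃ g, m.idxFun i = some g :=
        Option.ne_none_iff_exists'.1 fun h' => hcommon ⟨i, hi, h'⟩
      -- With no common active coordinate, the witness is read from the letter of `m` at an active
      -- coordinate of `l`.
      refine ⟨g₀.1 s, g₀.label s, fun j => ?_⟩
      cases hlj : l.idxFun j with
      | none =>
        obtain ⟨g, hmj⟩ : ∃ g, m.idxFun j = some g :=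
          Option.ne_none_iff_exists'.1 fun h' => hcommon ⟨j, hlj, h'⟩
        rw [coord_none hlj, coord_some hmj]
        refine g₀.agree ha g hR hA fun k => ?_
        have h1 := hc k i
        have h2 := hc k j
        rw [coord_none hi, coord_some hg₀] at h1
        rw [coord_none hlj, coord_some hmj] at h2
        exact h1.symm.trans h2
      | some g =>
        cases hmj : m.idxFun j with
        | none => rw [coord_some hlj, coord_none hmj, right j g hlj hmj]
        | some g' => rw [coord_some hlj, coord_some hmj, both j g g' hlj hmj]

end Letters

end Closed

/-! ### Partite steps by Hales–Jewett. -/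

section Steps

variable {L : FirstOrder.Language.{u, v}} {U : Set (Σ n, L.Relations n)}

theorem IsClosedEmb.id {V : Type*} [L.Structure V] : IsClosedEmb U (id : V → V) :=
  ⟨injective_id, fun _ _ => Iff.rfl, fun _ _ x _ _ => ⟨x _, rfl⟩⟩

theorem Covered.refl {V X : Type*} [L.Structure V] (p : V → X) : Covered U p p :=
  fun _ _ x hx => ⟨_, IsClosedEmb.id, rfl, x, hx, rfl⟩

instance {α ι : Type*} [Finite α] [Finite ι] : Finite (Combinatorics.Line α ι) :=
  Finite.of_injective Combinatorics.Line.idxFun fun _ _ h => Combinatorics.Line.ext h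

/-- The partite step over a good family of labels. -/
theorem IsGood.exists_monoOver [L.IsRelational] {A V : Type w} {X : Type*} [L.Structure A]
    [L.Structure V] [Finite A] [Finite V] {p : V → X} {a : A → X} (ha : Injective a)
    (hg : IsGood U p a) :
    ∃ (W : Type w) (_ : L.Structure W) (_ : Finite W) (q : W → X),
      Covered U p q ∧ MonoOver (A := A) U p q {a} := by
  obtain ⟨ι, _, hι⟩ := Combinatorics.Line.exists_mono_in_high_dimension (Copy U p a) (Fin 2)
  let S := imageStructure (L := L) (lineMap : Combinatorics.Line (Copy U p a) ι → V → _)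
  let q : (A × (ι → V)) ⊕ (Combinatorics.Line (Copy U p a) ι × V) → X :=
    Sum.elim (fun x => a x.1) fun x => p x.2
  have hq : ∀ l : Combinatorics.Line (Copy U p a) ι, q ∘ lineMap l = p := by
    intro l
    funext x
    by_cases hx : ∃ s, p x = a s
    · obtain ⟨s, hs⟩ := hx
      simp [q, lineMap_inside ha l hs, hs]
    · simp [q, lineMap_outside l hx]
  refine ⟨_, S, inferInstance, q, ?_, ?_⟩
  · rintro n R x ⟨l, y, hy, rfl⟩
    exact ⟨lineMap l, isClosedEmb_lineMap ha hg l, hq l, y, hy, rfl⟩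
  · intro χ
    obtain ⟨l, c, hc⟩ := hι fun b => χ fun s => Sum.inl (s, fun i => (b i).1 s)
    have key : ∀ g : Copy U p a, χ (lineMap l ∘ g.1) = c := by
      intro g
      rw [← hc g]
      congr 1
      funext s
      rw [comp_apply, lineMap_inside ha l (g.label s), coord_copy]
    refine ⟨lineMap l, isClosedEmb_lineMap ha hg l, hq l, ?_⟩
    rintro _ rfl g g' hg hg' hp hp'
    rw [key ⟨g, hg, hp⟩, key ⟨g', hg', hp'⟩]

/-- Partite steps can be iterated over a finite set of labellings. -/
theorem exists_monoOver_of_finite {A V : Type w} {X : Type*} [L.Structure A] [L.Structure V]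
    [Finite V] (p : V → X) {S : Set (A → X)} (hS : S.Finite)
    (step : ∀ a ∈ S, ∀ (W : Type w) [L.Structure W] [Finite W] (q : W → X), Covered U p q →
      ∃ (W' : Type w) (_ : L.Structure W') (_ : Finite W') (q' : W' → X),
        Covered U q q' ∧ MonoOver (A := A) U q q' {a}) :
    ∃ (W : Type w) (_ : L.Structure W) (_ : Finite W) (q : W → X),
      Covered U p q ∧ MonoOver (A := A) U p q S := by
  induction S, hS using Set.Finite.induction_on with
  | empty =>
    exact ⟨V, inferInstance, inferInstance, p, .refl p,
      fun χ => ⟨_, .id, rfl, fun a ha => ha.elim⟩⟩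
  | @insert a S _ _ ih =>
    obtain ⟨W, _, _, q, hc, hm⟩ := ih fun b hb => step b (Set.mem_insert_of_mem _ hb)
    obtain ⟨W', _, _, q', hc', hm'⟩ := step a (Set.mem_insert _ _) W q hc
    refine ⟨W', inferInstance, inferInstance, q', hc.trans hc', fun χ => ?_⟩
    obtain ⟨e', he', hq', h'⟩ := hm' χ
    -- The later step treats `a`; the earlier ones are applied to the colouring pulled back along
    -- `e'`.
    obtain ⟨e, he, hq, h⟩ := hm fun g => χ (e' ∘ g)
    refine ⟨e' ∘ e, he'.comp he, by rw [← comp_assoc, hq', hq], ?_⟩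
    rintro b (rfl | hb) g g' hg hg' hp hp'
    · exact h' b rfl (e ∘ g) (e ∘ g') (he.comp hg) (he.comp hg')
        (by rw [← comp_assoc, hq, hp]) (by rw [← comp_assoc, hq, hp'])
    · exact h b hb g g' hg hg' hp hp'

/-- The partite step over an arbitrary labelling: an inner partite construction whose base is the
set of words of copies. -/
theorem exists_monoOver_singleton [L.IsRelational] (hU : ∀ R ∈ U, 2 ≤ R.1) {A V : Type w}
    {X : Type w} [L.Structure A] [L.Structure V] [Finite A] [Finite V] (p : V → X) {a : A → X}
    (ha : Injective a) :
    ∃ (W : Type w) (_ : L.Structure W) (_ : Finite W) (q : W → X),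
      Covered U p q ∧ MonoOver (A := A) U p q {a} := by
  classical
  obtain ⟨ι, _, hι⟩ := Combinatorics.Line.exists_mono_in_high_dimension (Copy U p a) (Fin 2)
  let S₀ := imageStructure (L := L)
    (fun (l : Combinatorics.Line (Copy U p a) ι) (x : V) => (l, x))
  -- The inner labels: words for inside vertices, only the old label for outside ones.
  let forget : (A × (ι → V)) ⊕ (Combinatorics.Line (Copy U p a) ι × V) → (A × (ι → V)) ⊕ X :=
    Sum.map id fun x => p x.2
  let p₀ : Combinatorics.Line (Copy U p a) ι × V → (A × (ι → V)) ⊕ X :=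
    fun x => forget (lineMap x.1 x.2)
  let r : (A × (ι → V)) ⊕ X → X := Sum.elim (fun x => a x.1) id
  let word : (ι → Copy U p a) → A → (A × (ι → V)) ⊕ X :=
    fun b s => .inl (s, fun i => (b i).1 s)
  have hin : ∀ l x s, p x = a s → p₀ (l, x) = .inl (s, coord l x s) := by
    intro l x s hs
    simp [p₀, forget, lineMap_inside ha l hs]
  have hout : ∀ l x, (¬ ∃ s, p x = a s) → p₀ (l, x) = .inr (p x) := by
    intro l x hx
    simp [p₀, forget, lineMap_outside l hx]
  have hr : ∀ l, (r ∘ p₀) ∘ (fun x => (l, x)) = p := by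
    intro l
    funext x
    by_cases hx : ∃ s, p x = a s
    · obtain ⟨s, hs⟩ := hx
      simp [hin l x s hs, r, hs]
    · simp [hout l x hx, r]
  have hword : ∀ b, Injective (word b) := by
    intro b s t h
    simp only [word, Sum.inl.injEq, Prod.mk.injEq] at h
    exact h.1
  have hline : ∀ l : Combinatorics.Line (Copy U p a) ι,
      IsClosedEmb U fun x : V => (l, x) := isClosedEmb_prodMk hU
  have hcov : Covered U p (r ∘ p₀) := by
    rintro n R x ⟨l, y, hy, rfl⟩
    exact ⟨_, hline l, hr l, y, hy, rfl⟩
  -- At an active coordinate `i₀` of `l` the tuple starts in the closed copy `b i₀`. Hence it ends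
  -- there and comes from `A`; this determines the remaining coordinates.
  have hgood : ∀ b, IsGood U p₀ (word b) := by
    rintro b n R hR _ t ⟨l, z, hz, rfl⟩ hk
    have hz' : ∀ k, p (z k.castSucc) = a (t k) ∧
        ∀ i, coord l (z k.castSucc) (t k) i = (b i).1 (t k) := by
      intro k
      have := hk k
      simp only [comp_apply] at this
      by_cases hx : ∃ s, p (z k.castSucc) = a s
      · obtain ⟨s, hs⟩ := hx
        simp only [hin l _ s hs, word, Sum.inl.injEq, Prod.mk.injEq] at this
        obtain ⟨rfl, h⟩ := this
        exact ⟨hs, congrFun h⟩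
      · rw [hout l _ hx] at this
        cases this
    have hact : ∀ i, l.idxFun i = none → ∀ k, z k.castSucc = (b i).1 (t k) := by
      intro i hi k
      simpa [coord_none hi] using (hz' k).2 i
    obtain ⟨i₀, hi₀⟩ := l.proper
    obtain ⟨s, hs⟩ := (b i₀).2.1.closed R hR z hz fun k => ⟨t k, (hact i₀ hi₀ k).symm⟩
    have hps : p (z (Fin.last n)) = a s := by rw [← hs, (b i₀).label]
    have hA : Structure.RelMap R (Fin.snoc t s : Fin (n + 1) → A) := by
      rw [← (b i₀).2.1.rel]
      convert hz using 1
      funext k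
      refine Fin.lastCases ?_ (fun k => ?_) k
      · simpa using hs
      · simpa using (hact i₀ hi₀ k).symm
    refine ⟨s, ?_, hA⟩
    simp only [comp_apply]
    rw [hin l _ s hps]
    simp only [word]
    congr 2
    funext i
    cases hi : l.idxFun i with
    | none => rw [coord_none hi, (b i).last_eq ha hR hz (hact i hi) hps]
    | some g =>
      rw [coord_some hi]
      exact g.agree ha (b i) hR hA fun k => by simpa [coord_some hi] using (hz' k).2 i
  obtain ⟨W, _, _, q, hc, hm⟩ := exists_monoOver_of_finite (U := U) (A := A) p₀
    (Set.finite_range word) (by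
      rintro _ ⟨b, rfl⟩ W _ _ q hc
      exact ((hgood b).of_covered hc).exists_monoOver (hword b))
  have hc' : Covered U (r ∘ p₀) (r ∘ q) := by
    intro n R x hx
    obtain ⟨e, he, hqe, h⟩ := hc n R x hx
    exact ⟨e, he, by rw [comp_assoc, hqe], h⟩
  refine ⟨W, inferInstance, inferInstance, r ∘ q, hcov.trans hc', fun χ => ?_⟩
  obtain ⟨e, he, hqe, h⟩ := hm χ
  -- By `h` the colour of a copy depends only on its word, so words can be coloured. The value 0 is
  -- for words of no closed copy and never occurs on a line.
  obtain ⟨l, c, hl⟩ := hι fun b =>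
    if h : ∃ g : A → Combinatorics.Line (Copy U p a) ι × V, IsClosedEmb U g ∧ p₀ ∘ g = word b
      then χ (e ∘ h.choose) else 0
  refine ⟨e ∘ fun x => (l, x), he.comp (hline l), ?_, ?_⟩
  · rw [← comp_assoc, comp_assoc r, hqe, hr]
  have key : ∀ g : Copy U p a, χ ((e ∘ fun x => (l, x)) ∘ g.1) = c := by
    intro g
    have hg : IsClosedEmb U ((fun x : V => (l, x)) ∘ g.1) := (hline l).comp g.2.1
    have hp : p₀ ∘ ((fun x : V => (l, x)) ∘ g.1) = word (l g) := by
      funext s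
      simp only [comp_apply, word]
      rw [hin l _ s (g.label s), coord_copy]
    have hex : ∃ g' : A → Combinatorics.Line (Copy U p a) ι × V,
        IsClosedEmb U g' ∧ p₀ ∘ g' = word (l g) := ⟨_, hg, hp⟩
    have := hl g
    beta_reduce at this
    rw [dif_pos hex] at this
    rw [← this, comp_assoc]
    exact h _ ⟨_, rfl⟩ _ _ hg hex.choose_spec.1 hp hex.choose_spec.2
  rintro _ rfl g g' hg hg' hp hp'
  rw [key ⟨g, hg, hp⟩, key ⟨g', hg', hp'⟩]

end Steps

/-! ### Finite Ramsey theorem for sets and increasing maps. -/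

section FiniteRamsey

/-- The finite Ramsey theorem for sets. -/
theorem exists_ramsey_finset (κ : Type*) [Finite κ] (k m : ℕ) :
    ∃ N : ℕ, ∀ T : Finset ℕ, N ≤ T.card → ∀ χ : Finset ℕ → κ,
      ∃ H ⊆ T, H.card = m ∧ ∃ c, ∀ s ⊆ H, s.card = k → χ s = c := by
  classical
  have := Fintype.ofFinite κ
  induction k generalizing m with
  | zero =>
    refine ⟨m, fun T hT χ => ?_⟩
    obtain ⟨H, hH, hm⟩ := Finset.exists_subset_card_eq hT
    exact ⟨H, hH, hm, χ ∅, fun s _ hs => by rw [Finset.card_eq_zero.1 hs]⟩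
  | succ k ih =>
    -- Arbitrarily large sets exist on which the colour of a `(k + 1)`-subset depends only on its
    -- minimum; pigeonhole on the minima then finishes.
    have pre : ∀ q : ℕ, ∃ N : ℕ, ∀ T : Finset ℕ, N ≤ T.card → ∀ χ : Finset ℕ → κ,
        ∃ H ⊆ T, H.card = q ∧ ∃ c : ℕ → κ, ∀ s ⊆ H, s.card = k + 1 → ∀ x ∈ s,
          (∀ y ∈ s, x ≤ y) → χ s = c x := by
      intro q
      induction q with
      | zero =>
        refine ⟨0, fun T _ χ => ⟨∅, Finset.empty_subset _, rfl, fun _ => χ ∅, ?_⟩⟩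
        intro s hs hc
        rw [Finset.subset_empty.1 hs] at hc
        simp at hc
      | succ q ihq =>
        obtain ⟨N, hN⟩ := ihq
        obtain ⟨N', hN'⟩ := ih N
        refine ⟨N' + 1, fun T hT χ => ?_⟩
        have hne : T.Nonempty := Finset.card_pos.1 (by omega)
        set x₀ := T.min' hne with hx₀
        have hx₀T : x₀ ∈ T := T.min'_mem hne
        obtain ⟨H', hH', hc', c₀, h₀⟩ := hN' (T.erase x₀)
          (by rw [Finset.card_erase_of_mem hx₀T]; omega) fun s => χ (insert x₀ s)
        obtain ⟨H, hH, hc, c, h⟩ := hN H' hc'.ge χ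
        have hHT : H ⊆ T.erase x₀ := hH.trans hH'
        have hx₀H : x₀ ∉ H := fun hx => by simpa using hHT hx
        refine ⟨insert x₀ H, ?_, by rw [Finset.card_insert_of_notMem hx₀H, hc],
          update c x₀ c₀, ?_⟩
        · exact Finset.insert_subset hx₀T (hHT.trans (Finset.erase_subset _ _))
        · intro s hs hcard x hx hmin
          by_cases hxs : x₀ ∈ s
          · have hle : x₀ ≤ x := by
              rcases Finset.mem_insert.1 (hs hx) with h' | hx'
              · exact h'.ge
              · exact T.min'_le _ (Finset.mem_of_mem_erase (hHT hx'))
            have hxx : x = x₀ := le_antisymm (hmin _ hxs) hle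
            rw [hxx, update_self, ← h₀ (s.erase x₀), Finset.insert_erase hxs]
            · intro y hy
              have := hs (Finset.mem_of_mem_erase hy)
              exact hH ((Finset.mem_insert.1 this).resolve_left (Finset.ne_of_mem_erase hy))
            · rw [Finset.card_erase_of_mem hxs, hcard]; rfl
          · have hsH : s ⊆ H := fun y hy =>
              (Finset.mem_insert.1 (hs hy)).resolve_left fun h' => hxs (h' ▸ hy)
            rw [update_of_ne (show x ≠ x₀ from fun h' => hxs (h' ▸ hx))]
            exact h s hsH hcard x hx hmin
    obtain ⟨N, hN⟩ := pre (Fintype.card κ * m)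
    refine ⟨N, fun T hT χ => ?_⟩
    obtain ⟨H, hH, hc, c, h⟩ := hN T hT χ
    rcases isEmpty_or_nonempty κ with hκ | hκ
    · exact (hκ.false (χ ∅)).elim
    obtain ⟨d, -, hd⟩ := Finset.exists_le_card_fiber_of_mul_le_card_of_maps_to
      (s := H) (t := Finset.univ) (f := c) (n := m) (fun _ _ => Finset.mem_univ _)
      Finset.univ_nonempty (by rw [hc, Finset.card_univ])
    obtain ⟨H', hH', hm⟩ := Finset.exists_subset_card_eq hd
    have hH'H : H' ⊆ H := hH'.trans (Finset.filter_subset _ _)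
    refine ⟨H', hH'H.trans hH, hm, d, fun s hs hcard => ?_⟩
    have hne : s.Nonempty := Finset.card_pos.1 (by omega)
    have hmem := s.min'_mem hne
    rw [h s (hs.trans hH'H) hcard _ hmem fun y hy => s.min'_le y hy]
    exact (Finset.mem_filter.1 (hH' (hs hmem))).2

/-- The finite Ramsey theorem for increasing maps of finite linear orders. -/
theorem exists_ramsey_strictMono (A B : Type*) [LinearOrder A] [LinearOrder B] [Finite A]
    [Finite B] (κ : Type*) [Finite κ] [Nonempty κ] :
    ∃ N : ℕ, ∀ χ : (A → Fin N) → κ, ∃ f : B → Fin N, StrictMono f ∧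
      ∃ c, ∀ e : A → B, StrictMono e → χ (f ∘ e) = c := by
  classical
  have := Fintype.ofFinite A
  have := Fintype.ofFinite B
  obtain ⟨N, hN⟩ := exists_ramsey_finset κ (Fintype.card A) (Fintype.card B)
  refine ⟨N, fun χ => ?_⟩
  have hinj : ∀ g g' : A → Fin N, StrictMono g → StrictMono g' →
      Finset.univ.image (fun x => (g x : ℕ)) = Finset.univ.image (fun x => (g' x : ℕ)) →
      g = g' := by
    intro g g' hg hg' h
    have hr : Set.range g = Set.range g' := by
      ext y
      have := Finset.ext_iff.1 h y
      simpa [Fin.ext_iff] using this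
    exact (hg.range_inj hg').1 hr
  obtain ⟨H, hHT, hcard, c, hc⟩ := hN (Finset.range N) (by simp) fun s =>
    if h : ∃ g : A → Fin N, StrictMono g ∧ Finset.univ.image (fun x => (g x : ℕ)) = s
      then χ h.choose else Classical.arbitrary κ
  let i := H.orderIsoOfFin hcard
  let j := (Fintype.orderIsoFinOfCardEq B rfl).symm
  let f : B → Fin N := fun b => ⟨(i (j b) : ℕ), Finset.mem_range.1 (hHT (i (j b)).2)⟩
  have hf : StrictMono f := fun b b' hb => by
    have : i (j b) < i (j b') := i.strictMono (j.strictMono hb)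
    exact this
  refine ⟨f, hf, c, fun e he => ?_⟩
  have hex : ∃ g : A → Fin N, StrictMono g ∧ Finset.univ.image (fun x => (g x : ℕ)) =
      Finset.univ.image (fun x => ((f ∘ e) x : ℕ)) := ⟨_, hf.comp he, rfl⟩
  have := hc (Finset.univ.image (fun x => ((f ∘ e) x : ℕ))) ?_ ?_
  · rw [dif_pos hex] at this
    rw [← this]
    exact congrArg χ (hinj _ _ (hf.comp he) hex.choose_spec.1 hex.choose_spec.2.symm)
  · intro y hy
    obtain ⟨x, -, rfl⟩ := Finset.mem_image.1 hy
    exact (i (j (e x))).2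
  · exact (Finset.card_image_of_injective _
      (Fin.val_injective.comp (hf.comp he).injective)).trans Finset.card_univ

end FiniteRamsey

/-! ### Changing the interpretation of the order symbol. -/

section Order

variable {L : FirstOrder.Language.{u, v}} {U : Set (Σ n, L.Relations n)}

/-- The underlying map of a `U`-closed embedding. -/
theorem UEmb.isClosedEmb {M N : Type w} [L.Structure M] [L.Structure N] (f : UEmb U M N) :
    IsClosedEmb U (f.1 : M → N) :=
  ⟨f.1.injective, fun R x => f.1.map_rel R x, fun {n} R hR x hx h => by
    have := f.2 n R hR x hx fun i => Hom.mem_range.2 (h i)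
    exact Hom.mem_range.1 this⟩

/-- A closed map of relational structures as an element of `UEmb`. -/
def IsClosedEmb.toUEmb [L.IsRelational] {M N : Type w} [L.Structure M] [L.Structure N] {f : M → N}
    (hf : IsClosedEmb U f) : UEmb U M N :=
  ⟨⟨⟨f, hf.inj⟩, fun g => isEmptyElim g, fun R x => hf.rel R x⟩, fun _ R hR x hx h =>
    Hom.mem_range.2 (hf.closed R hR x hx fun i => Hom.mem_range.1 (h i))⟩

/-- Replace the interpretation of the symbol `lt` by the relation `r`. -/
@[reducible] def reorder [L.IsRelational] (lt : L.Relations 2) {V : Type*} (S : L.Structure V)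
    (r : V → V → Prop) : L.Structure V where
  funMap f := isEmptyElim f
  RelMap {n} R x := (∃ h : n = 2, h ▸ R = lt ∧ r (x (Fin.cast h.symm 0)) (x (Fin.cast h.symm 1))) ∨
    ((⟨n, R⟩ : Σ n, L.Relations n) ≠ ⟨2, lt⟩ ∧ S.RelMap R x)

theorem reorder_relMap_lt [L.IsRelational] (lt : L.Relations 2) {V : Type*} (S : L.Structure V)
    (r : V → V → Prop) (x : Fin 2 → V) :
    (reorder lt S r).RelMap lt x ↔ r (x 0) (x 1) := by
  constructor
  · rintro (⟨_, _, h⟩ | ⟨h, _⟩)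
    · exact h
    · exact (h rfl).elim
  · exact fun h => .inl ⟨rfl, rfl, h⟩

theorem reorder_relMap_of_ne [L.IsRelational] (lt : L.Relations 2) {V : Type*} (S : L.Structure V)
    (r : V → V → Prop) {n : ℕ} {R : L.Relations n}
    (hR : (⟨n, R⟩ : Σ n, L.Relations n) ≠ ⟨2, lt⟩) (x : Fin n → V) :
    (reorder lt S r).RelMap R x ↔ S.RelMap R x := by
  constructor
  · rintro (⟨rfl, h, -⟩ | ⟨-, h⟩)
    · exact (hR (by rw [← h])).elim
    · exact h
  · exact fun h => .inr ⟨hR, h⟩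

/-- Closed embeddings stay closed when the order of the target is changed without affecting the
image. -/
theorem IsClosedEmb.reorder [L.IsRelational] {lt : L.Relations 2}
    (hlt : (⟨2, lt⟩ : Σ n, L.Relations n) ∉ U) {M V : Type*} [L.Structure M] {S : L.Structure V}
    {r : V → V → Prop} {f : M → V} (hf : IsClosedEmb U f)
    (hr : ∀ x y : M, r (f x) (f y) ↔ Structure.RelMap lt ![x, y]) :
    letI := reorder lt S r
    IsClosedEmb U f := by
  refine @IsClosedEmb.mk L U M V _ (UClosedRamsey.reorder lt S r) f hf.inj ?_ ?_
  · intro n R x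
    by_cases hR : (⟨n, R⟩ : Σ n, L.Relations n) = ⟨2, lt⟩
    · cases hR
      refine (reorder_relMap_lt lt S r _).trans ((hr _ _).trans ?_)
      rw [show ![x 0, x 1] = x from funext fun i => by fin_cases i <;> rfl]
    · exact (reorder_relMap_of_ne lt S r hR _).trans (hf.rel R x)
  · intro n R hR x hx h
    refine hf.closed R hR x ((reorder_relMap_of_ne lt S r ?_ _).1 hx) h
    exact fun h => hlt (h ▸ hR)

end Order

end UClosedRamsey

/-! ### The outer partite construction and the final order. -/

theorem mainTheorem11 (L : FirstOrder.Language.{u, v}) [L.IsRelational] (lt : L.Relations 2)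
    (U : Set (Σ n, L.Relations n)) (hU : ∀ R ∈ U, 2 ≤ R.1)
    (hlt : (⟨2, lt⟩ : Σ n, L.Relations n) ∉ U)
    (A B : Type w) [L.Structure A] [L.Structure B] [Finite A] [Finite B]
    (hA : UClosedRamsey.IsOrdered lt A) (hB : UClosedRamsey.IsOrdered lt B) :
    ∃ (C : Type w) (_ : L.Structure C), Finite C ∧ UClosedRamsey.IsOrdered lt C ∧
      UClosedRamsey.Arrow U C B A 2 := by
  classical
  open UClosedRamsey FirstOrder.Language Function in
  let _ : LinearOrder A := @linearOrderOfSTO A _ hA _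
  let _ : LinearOrder B := @linearOrderOfSTO B _ hB _
  have hltA : ∀ x y : A, x < y ↔ Structure.RelMap lt ![x, y] := fun _ _ => Iff.rfl
  have hltB : ∀ x y : B, x < y ↔ Structure.RelMap lt ![x, y] := fun _ _ => Iff.rfl
  obtain ⟨N, hN⟩ := exists_ramsey_strictMono A B (Fin 2)
  let I : Type w := ULift.{w} {f : B → Fin N // StrictMono f}
  let S₀ := imageStructure (L := L) (fun (i : I) (b : B) => (i, b))
  let p : I × B → ULift.{w} (Fin N) := fun x => ⟨x.1.down.1 x.2⟩
  obtain ⟨W, SW, _, q, hc, hm⟩ := exists_monoOver_of_finite (U := U) (A := A) p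
    (S := {a | Injective a}) (Set.toFinite _)
    fun a ha W _ _ q _ => exists_monoOver_singleton hU q ha
  have hB₀ : ∀ i : I, IsClosedEmb U fun b : B => (i, b) := isClosedEmb_prodMk hU
  -- By covering, a pair related by `lt` comes from a copy of `B`, whose labelling is increasing.
  have hqlt : ∀ x : Fin 2 → W, Structure.RelMap lt x → q (x 0) < q (x 1) := by
    intro x hx
    obtain ⟨e, -, hqe, y, ⟨i, z, hz, rfl⟩, rfl⟩ := hc 2 lt x hx
    have hz' : z 0 < z 1 := by
      rw [hltB]
      convert hz using 1
      funext i
      fin_cases i <;> rfl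
    have h := fun x => congrFun hqe x
    simp only [comp_apply] at h
    simp only [comp_apply, h]
    exact i.down.2 hz'
  obtain ⟨m, ⟨σ⟩⟩ := Finite.exists_equiv_fin W
  -- Labels come first so that the new order extends `lt`; `σ` only breaks ties.
  let key : W → ULift.{w} (Fin N) ×ₗ Fin m := fun x => toLex (q x, σ x)
  have hkey : Injective key := fun x y h => σ.injective (congrArg (fun z => (ofLex z).2) h)
  let r : W → W → Prop := fun x y => key x < key y
  have hr : ∀ {M : Type w} [L.Structure M] [LinearOrder M] (f : M → W),
      (∀ x y : M, x < y ↔ Structure.RelMap lt ![x, y]) → IsClosedEmb U f →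
      ∀ x y, r (f x) (f y) ↔ Structure.RelMap lt ![x, y] := by
    intro M _ _ f hM hf x y
    have hmono : StrictMono (key ∘ f) := by
      intro x y hxy
      rw [hM, ← hf.rel] at hxy
      exact Prod.Lex.toLex_lt_toLex.2 (.inl (hqlt _ hxy))
    rw [← hM]
    exact hmono.lt_iff_lt
  let SC := reorder lt SW r
  refine ⟨W, SC, inferInstance, ?_, fun χ => ?_⟩
  · have hrr : (fun x y : W => SC.RelMap lt ![x, y]) = r := by
      funext x y
      exact propext (reorder_relMap_lt lt SW r _)
    rw [UClosedRamsey.IsOrdered, hrr]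
    exact (RelEmbedding.mk ⟨key, hkey⟩ Iff.rfl : r ↪r (· < ·)).isStrictTotalOrder
  obtain ⟨e, he, hqe, h⟩ := hm fun g =>
    if hg : @IsClosedEmb L U A W _ SC g then χ hg.toUEmb else 0
  -- By `h` the colour no longer depends on the chosen copy, so it is a colouring of labellings.
  obtain ⟨f, hf, c, hfc⟩ := hN fun a =>
    if hg : ∃ g : A → I × B, IsClosedEmb U g ∧ p ∘ g = ULift.up ∘ a then
      (if hg' : @IsClosedEmb L U A W _ SC (e ∘ hg.choose) then χ hg'.toUEmb else 0) else 0
  have hfe : @IsClosedEmb L U B W _ SW (e ∘ fun b => (⟨f, hf⟩, b)) :=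
    @IsClosedEmb.comp L U B (I × B) W _ _ SW _ _ he (hB₀ _)
  have hfC : @IsClosedEmb L U B W _ SC (e ∘ fun b => (⟨f, hf⟩, b)) :=
    hfe.reorder hlt (hr _ hltB hfe)
  refine ⟨hfC.toUEmb, ?_⟩
  suffices H : ∀ g : UEmb U A B, χ (hfC.toUEmb.comp g) = c by
    intro g g'
    rw [H, H]
  intro g
  have hg : IsClosedEmb U ((fun b : B => ((⟨f, hf⟩ : I), b)) ∘ g.1) := (hB₀ _).comp g.isClosedEmb
  have hgm : StrictMono g.1 := by
    intro x y hxy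
    rw [hltA, ← g.isClosedEmb.rel] at hxy
    rw [hltB]
    convert hxy using 1
    funext i
    fin_cases i <;> rfl
  have hex : ∃ g' : A → I × B, IsClosedEmb U g' ∧ p ∘ g' = ULift.up ∘ (f ∘ g.1) := ⟨_, hg, rfl⟩
  have h1 := hfc g.1 hgm
  have h2 := h (ULift.up ∘ (f ∘ g.1)) (ULift.up_injective.comp (hf.comp hgm).injective)
    _ _ hg hex.choose_spec.1 rfl hex.choose_spec.2
  beta_reduce at h1 h2
  rw [dif_pos hex, ← h2] at h1
  have hgC : @IsClosedEmb L U A W _ SC ((e ∘ fun b => (⟨f, hf⟩, b)) ∘ g.1) :=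
    hfC.comp g.isClosedEmb
  rw [← h1, ← comp_assoc, dif_pos hgC]
  rfl
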